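/- Let $K(x)=\int_0^{\pi/2}\frac{d\theta}{\sqrt{1-x^2\sin^2\theta}}$ for $0<x<1$ be the complete elliptic integral of the first kind, let $\vartheta_3(q)=\sum_{n\in\mathbb Z}q^{n^2}$ for $|q|<1$, and let $(a)_n=a(a+1)\cdots(a+n-1)$, $(a)_0=1$. For every real $r>0$ there is exactly one $k_r\in(0,1)$ (the elliptic singular modulus) with $$\frac{K\left(\sqrt{1-k_r^2}\right)}{K(k_r)}=\sqrt r ,$$ and for this $k_r$ and $q=e^{-\pi\sqrt r}$ the following series converges and $$\sum_{n=0}^{\infty}\frac{\left(\frac32\right)_n\left(-\frac12\right)_n}{(n!)^2}\,k_r^{2n}\left[-4(1-k_r^2)n+1-2k_r^2\right]=\frac{2K(k_r)}{\pi}=\vartheta_3(q)^2 .$$ -/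

import Mathlib

namespace SingularModuli

/-- The complete elliptic integral of the first kind as a function of the modulus `x`,
`K(x) = ∫₀^{π/2} dθ / √(1 - x² sin² θ)`. It is only used for `0 < x < 1`, where the integrand is
continuous. -/
noncomputable def ellipticK (x : ℝ) : ℝ :=
  ∫ θ in (0 : ℝ)..(Real.pi / 2), 1 / Real.sqrt (1 - x ^ 2 * Real.sin θ ^ 2)

/-- `k` is the elliptic singular modulus `k_r`: the number `k` in `(0, 1)` that satisfies
`K(√(1 - k²)) / K(k) = √r`. -/
def IsSingularModulus (r k : ℝ) : Prop :=
  0 < k ∧ k < 1 ∧ ellipticK (Real.sqrt (1 - k ^ 2)) / ellipticK k = Real.sqrt r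

/-- The theta function `ϑ₃(q) = ∑_{n ∈ ℤ} q^{n²}`. -/
noncomputable def theta3 (q : ℝ) : ℝ := ∑' n : ℤ, q ^ (n ^ 2)

/-- The Pochhammer symbol `(a)_n = a (a + 1) ⋯ (a + n - 1)`. -/
noncomputable def poch (a : ℝ) (n : ℕ) : ℝ := (ascPochhammer ℝ n).eval a

end SingularModuli

/-!
The theta functions parametrise the arithmetic-geometric mean: with `ϑ₃, ϑ₄` at the nome
`exp (-π s)`, passing from `s` to `2 s` replaces `(ϑ₃², ϑ₄²)` by its arithmetic and geometric means
(`thetaNull_sq_add_thetaAlt_sq`, `thetaNull_mul_thetaAlt`). Both facts are one count of the lattice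
points `(u, v)` of equal parity (`thetaNull_two_mul_sq`). Gauss's integral
`∫₀^∞ dt / √((t² + a²)(t² + b²))` is invariant under this step (`gaussIntegral_mean`), and
`ϑ₃, ϑ₄ → 1` as `s → ∞`, so its value at `(ϑ₃², ϑ₄²)` is `π / 2` (`gaussIntegral_theta`). On the
other hand this value is `K(k) / ϑ₃²` for the modulus `k` with complementary modulus `ϑ₄² / ϑ₃²`,
whence `2 K(k) / π = ϑ₃²` (`ellipticK_thetaModulus`).

Jacobi's quartic identity (`thetaNull_pow_four`) says that the moduli at `s` and `1 / s` are
complementary, so that the inversion formula `ϑ₃(1 / s)² = s ϑ₃(s)²` gives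
`K(√(1 - k²)) / K(k) = s`. This proves existence of the singular modulus together with the theta
evaluation; uniqueness holds because `K` is strictly increasing.

The series differs from the hypergeometric series `2 K(k) / π = ∑ ((1/2)_n / n!)² k^{2n}` by a
telescoping sum (`hasSum_poch_series`).
-/

namespace SingularModuli

open Real Filter Topology MeasureTheory

/-! ### Theta constants -/

/-- The theta constant `ϑ₃` at the nome `exp (-π s)`, as a function of `s > 0`. -/
noncomputable def thetaNull (s : ℝ) : ℝ := ∑' n : ℤ, exp (-π * s * (n : ℝ) ^ 2)

/-- The theta constant `ϑ₄ = ∑ (-1)ⁿ q^{n²}` at the nome `q = exp (-π s)`. The even terms of `ϑ₃(q)`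
sum to `ϑ₃(q⁴)`, so that `ϑ₄(q) = 2 ϑ₃(q⁴) - ϑ₃(q)`; this is taken as the definition. -/
noncomputable def thetaAlt (s : ℝ) : ℝ := 2 * thetaNull (4 * s) - thetaNull s

lemma summable_exp_neg_mul_int_sq {s : ℝ} (hs : 0 < s) :
    Summable fun n : ℤ => exp (-π * s * (n : ℝ) ^ 2) := by
  have h := summable_pow_mul_jacobiTheta₂_term_bound 0 hs 0
  refine h.congr fun n => ?_
  simp only [pow_zero, one_mul]
  congr 1
  ring

lemma theta3_exp (s : ℝ) : theta3 (exp (-π * s)) = thetaNull s := by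
  unfold theta3 thetaNull
  refine tsum_congr fun n => ?_
  rw [← Real.rpow_intCast, ← Real.exp_mul]
  push_cast
  rfl

lemma thetaNull_pos {s : ℝ} (hs : 0 < s) : 0 < thetaNull s :=
  (summable_exp_neg_mul_int_sq hs).tsum_pos (fun _ => (exp_pos _).le) 0 (exp_pos _)

lemma thetaNull_strictAntiOn : StrictAntiOn thetaNull (Set.Ioi 0) := by
  intro s hs t ht hst
  refine Summable.tsum_lt_tsum (i := 1) (fun n => ?_) ?_ (summable_exp_neg_mul_int_sq ht)
    (summable_exp_neg_mul_int_sq hs)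
  · rw [exp_le_exp]
    nlinarith [mul_nonneg (mul_nonneg pi_pos.le (sub_nonneg.2 hst.le)) (sq_nonneg (n : ℝ))]
  · rw [exp_lt_exp]
    push_cast
    nlinarith [mul_pos pi_pos (sub_pos.2 hst)]

lemma tendsto_thetaNull_atTop : Tendsto thetaNull atTop (𝓝 1) := by
  have h : Tendsto thetaNull atTop (𝓝 (∑' n : ℤ, if n = 0 then (1 : ℝ) else 0)) := by
    refine tendsto_tsum_of_dominated_convergence (summable_exp_neg_mul_int_sq one_pos) ?_ ?_
    · intro n
      split_ifs with hn
      · simp [hn]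
      · have hn' : 0 < (n : ℝ) ^ 2 := by positivity
        refine tendsto_exp_atBot.comp ?_
        have : Tendsto (fun s : ℝ => (-π * (n : ℝ) ^ 2) * s) atTop atBot :=
          tendsto_id.const_mul_atTop_of_neg (by nlinarith [mul_pos pi_pos hn'])
        refine this.congr fun s => by ring
    · filter_upwards [eventually_ge_atTop 1] with s hs n
      rw [norm_of_nonneg (exp_pos _).le, exp_le_exp]
      nlinarith [mul_nonneg (mul_nonneg pi_pos.le (sub_nonneg.2 hs)) (sq_nonneg (n : ℝ))]
  simpa using h

lemma tendsto_thetaAlt_atTop : Tendsto thetaAlt atTop (𝓝 1) := by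
  have h := (tendsto_thetaNull_atTop.comp
    (tendsto_id.const_mul_atTop (by norm_num : (0 : ℝ) < 4))).const_mul 2
  have h' := h.sub tendsto_thetaNull_atTop
  norm_num at h'
  exact h'

/-- Jacobi's inversion formula, from Poisson summation. -/
lemma thetaNull_inv {s : ℝ} (hs : 0 < s) : thetaNull s⁻¹ = √s * thetaNull s := by
  have h := Real.tsum_exp_neg_mul_int_sq hs
  rw [← sqrt_eq_rpow] at h
  unfold thetaNull
  rw [h, ← mul_assoc, mul_one_div_cancel (sqrt_pos.2 hs).ne', one_mul]
  simp only [div_eq_mul_inv]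

/-- The pairs `(u, v)` of integers of equal parity are the pairs `(a + b, a - b)`. They are either
`(2m, 2n)`, on the left of the sum, or `(2m + 1, 2n + 1)`, on the right. -/
def sameParityEquiv : ℤ × ℤ ≃ (ℤ × ℤ) ⊕ (ℤ × ℤ) where
  toFun p := if Even (p.1 + p.2) then .inl ((p.1 + p.2) / 2, (p.1 - p.2) / 2)
    else .inr ((p.1 + p.2 - 1) / 2, (p.1 - p.2 - 1) / 2)
  invFun := Sum.elim (fun p => (p.1 + p.2, p.1 - p.2)) (fun p => (p.1 + p.2 + 1, p.1 - p.2))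
  left_inv := by
    rintro ⟨a, b⟩
    dsimp only
    split_ifs with h
    · obtain ⟨c, hc⟩ := h
      simp only [Sum.elim_inl, Prod.mk.injEq]
      omega
    · obtain ⟨c, hc⟩ := Int.not_even_iff_odd.1 h
      simp only [Sum.elim_inr, Prod.mk.injEq]
      omega
  right_inv := by
    rintro (⟨a, b⟩ | ⟨a, b⟩)
    · have h : Even (a + b + (a - b)) := ⟨a, by ring⟩
      simp only [Sum.elim_inl, h, if_true, Sum.inl.injEq, Prod.mk.injEq]
      omega
    · have h : ¬ Even (a + b + 1 + (a - b)) := Int.not_even_iff_odd.2 ⟨a, by ring⟩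
      simp only [Sum.elim_inr, h, if_false, Sum.inr.injEq, Prod.mk.injEq]
      omega

/-- The sum of the odd terms of `ϑ₃`. -/
lemma hasSum_odd_terms {s : ℝ} (hs : 0 < s) :
    HasSum (fun n : ℤ => exp (-π * s * (2 * n + 1 : ℝ) ^ 2)) (thetaNull s - thetaNull (4 * s)) := by
  have hf := summable_exp_neg_mul_int_sq hs
  have heinj : Function.Injective fun n : ℤ => 2 * n := fun a b h => by simpa using h
  have hoinj : Function.Injective fun n : ℤ => 2 * n + 1 := fun a b h => by simpa using h
  have heven : HasSum ((fun n : ℤ => exp (-π * s * (n : ℝ) ^ 2)) ∘ fun n : ℤ => 2 * n)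
      (thetaNull (4 * s)) := by
    refine (summable_exp_neg_mul_int_sq (by positivity : 0 < 4 * s)).hasSum.congr_fun fun n => ?_
    simp only [Function.comp_apply, Int.cast_mul, Int.cast_ofNat]
    ring_nf
  have hodd := (hf.comp_injective hoinj).hasSum
  have hre : (Set.range fun n : ℤ => 2 * n) = {n | Even n} := by
    ext n
    exact ⟨fun ⟨m, h⟩ => even_iff_exists_two_mul.2 ⟨m, h.symm⟩,
      fun h => (even_iff_exists_two_mul.1 h).imp fun _ h => h.symm⟩
  have hro : (Set.range fun n : ℤ => 2 * n + 1) = {n | Odd n} := by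
    ext n
    exact ⟨fun ⟨m, h⟩ => ⟨m, h.symm⟩, fun ⟨m, h⟩ => ⟨m, h.symm⟩⟩
  have hcompl : IsCompl (Set.range fun n : ℤ => 2 * n) (Set.range fun n : ℤ => 2 * n + 1) := by
    rw [hre, hro]
    exact Int.isCompl_even_odd
  have h := HasSum.add_isCompl (f := fun n : ℤ => exp (-π * s * (n : ℝ) ^ 2)) hcompl
    (heinj.hasSum_range_iff.2 heven) (hoinj.hasSum_range_iff.2 hodd)
  have e : thetaNull s = _ := hf.hasSum.unique h
  rw [e, add_sub_cancel_left]
  simpa [Function.comp_def] using hodd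

/-- `ϑ₃(q²)²` sums `q ^ (u² + v²)` over the pairs `(u, v)` of equal parity. -/
lemma thetaNull_two_mul_sq {s : ℝ} (hs : 0 < s) :
    thetaNull (2 * s) ^ 2 = thetaNull (4 * s) ^ 2 + (thetaNull s - thetaNull (4 * s)) ^ 2 := by
  have hprod : ∀ {f : ℤ → ℝ} {a : ℝ}, (∀ n, 0 ≤ f n) → HasSum f a →
      HasSum (fun p : ℤ × ℤ => f p.1 * f p.2) (a ^ 2) := fun h0 hf => by
    rw [sq]
    exact hf.mul hf (hf.summable.mul_of_nonneg hf.summable h0 h0)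
  have h2 := hprod (fun _ => (exp_pos _).le)
    (summable_exp_neg_mul_int_sq (by positivity : 0 < 2 * s)).hasSum
  have h4 := hprod (fun _ => (exp_pos _).le)
    (summable_exp_neg_mul_int_sq (by positivity : 0 < 4 * s)).hasSum
  have ho := hprod (fun _ => (exp_pos _).le) (hasSum_odd_terms hs)
  refine h2.unique ?_
  rw [← sameParityEquiv.symm.hasSum_iff]
  refine HasSum.sum (h4.congr_fun fun p => ?_) (ho.congr_fun fun p => ?_)
  all_goals
    simp only [Function.comp_apply, sameParityEquiv, Equiv.coe_fn_symm_mk, Sum.elim_inl,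
      Sum.elim_inr, ← Real.exp_add]
    push_cast
    ring_nf

/-- One step of the arithmetic mean in the theta parametrisation of the AGM. -/
lemma thetaNull_sq_add_thetaAlt_sq {s : ℝ} (hs : 0 < s) :
    thetaNull s ^ 2 + thetaAlt s ^ 2 = 2 * thetaNull (2 * s) ^ 2 := by
  rw [thetaNull_two_mul_sq hs, thetaAlt]
  ring

/-- One step of the geometric mean in the theta parametrisation of the AGM. -/
lemma thetaNull_mul_thetaAlt {s : ℝ} (hs : 0 < s) :
    thetaNull s * thetaAlt s = thetaAlt (2 * s) ^ 2 := by
  have h1 := thetaNull_two_mul_sq hs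
  have h2 := thetaNull_sq_add_thetaAlt_sq (by positivity : 0 < 2 * s)
  rw [show 2 * (2 * s) = 4 * s by ring] at h2
  unfold thetaAlt at h2 ⊢
  linear_combination h1 - h2

/-- The inversion of `ϑ₄` gives `ϑ₂(q) = ϑ₃(q^{1/4}) - ϑ₃(q)`. -/
lemma thetaAlt_inv {s : ℝ} (hs : 0 < s) :
    thetaAlt s⁻¹ = √s * (thetaNull (s / 4) - thetaNull s) := by
  have h := thetaNull_inv (by positivity : 0 < s / 4)
  rw [inv_div, div_eq_mul_inv, Real.sqrt_div hs.le, show (4 : ℝ) = 2 ^ 2 by norm_num,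
    Real.sqrt_sq zero_le_two] at h
  rw [thetaAlt, thetaNull_inv hs, show (4 : ℝ) = 2 ^ 2 by norm_num, h]
  ring

lemma thetaAlt_pos {s : ℝ} (hs : 0 < s) : 0 < thetaAlt s := by
  have hs' : 0 < s⁻¹ := by positivity
  rw [← inv_inv s, thetaAlt_inv hs']
  exact mul_pos (sqrt_pos.2 hs') (sub_pos.2 <|
    thetaNull_strictAntiOn (Set.mem_Ioi.2 (by positivity)) hs' (by linarith))

lemma thetaAlt_lt_thetaNull {s : ℝ} (hs : 0 < s) : thetaAlt s < thetaNull s := by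
  have h := thetaNull_strictAntiOn hs (Set.mem_Ioi.2 (by positivity : 0 < 4 * s)) (by linarith)
  unfold thetaAlt
  linarith

/-- Jacobi's quartic identity `ϑ₃⁴ = ϑ₄⁴ + ϑ₂⁴`, where `ϑ₂(q)²` is written as `s⁻¹ ϑ₄(q')²` with the
complementary nome `q' = exp (-π / s)`. -/
lemma thetaNull_pow_four {s : ℝ} (hs : 0 < s) :
    thetaNull s ^ 4 = thetaAlt s ^ 4 + (thetaAlt s⁻¹ ^ 2 / s) ^ 2 := by
  have hinv := thetaNull_inv (by positivity : 0 < 2 * s)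
  have hinv' := thetaNull_inv hs
  have hainv := thetaAlt_inv (by positivity : 0 < 2 * s)
  have hr2 := sq_sqrt (by positivity : 0 ≤ 2 * s)
  have hr := sq_sqrt hs.le
  have hu : 0 < (2 * s)⁻¹ := by positivity
  have hsu : 2 * (2 * s)⁻¹ = s⁻¹ := by field_simp
  have hA := thetaNull_sq_add_thetaAlt_sq hs
  -- The two mean identities at `1 / (2s)`, carried to `2s` by inversion.
  have hA' := thetaNull_sq_add_thetaAlt_sq hu
  have hB' := thetaNull_mul_thetaAlt hu
  rw [hsu, hinv, hainv] at hA' hB'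
  rw [hinv'] at hA'
  have h1 : thetaNull (2 * s) ^ 2 + (thetaNull (2 * s / 4) - thetaNull (2 * s)) ^ 2
      = thetaNull s ^ 2 := by
    apply mul_left_cancel₀ (by positivity : 2 * s ≠ 0)
    linear_combination hA' - (thetaNull (2 * s) ^ 2
      + (thetaNull (2 * s / 4) - thetaNull (2 * s)) ^ 2) * hr2 + 2 * thetaNull s ^ 2 * hr
  have h2 : thetaAlt s⁻¹ ^ 2 / s
      = 2 * thetaNull (2 * s) * (thetaNull (2 * s / 4) - thetaNull (2 * s)) := by
    rw [div_eq_iff hs.ne']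
    linear_combination (thetaNull (2 * s) * (thetaNull (2 * s / 4) - thetaNull (2 * s))) * hr2 - hB'
  rw [h2]
  linear_combination (thetaNull s ^ 2 - thetaAlt s ^ 2) * hA
    - 4 * thetaNull (2 * s) ^ 2 * h1 - 2 * thetaNull (2 * s) ^ 2 * hA

/-! ### Gauss's integral -/

/-- Gauss's integral `∫₀^∞ dt / √((t² + a²)(t² + b²))`, which is `π / (2 agm(a, b))`. -/
noncomputable def gaussIntegral (a b : ℝ) : ℝ :=
  ∫ t in Set.Ioi (0 : ℝ), 1 / √((t ^ 2 + a ^ 2) * (t ^ 2 + b ^ 2))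

/-- Gauss's integral is unchanged when `a, b` are replaced by their arithmetic and geometric means.
The substitution `u = (t - ab/t) / 2` maps `(0, ∞)` onto the whole line. -/
lemma gaussIntegral_mean {a b c : ℝ} (ha : 0 < a) (hb : 0 < b) (hc : a * b = c ^ 2) :
    gaussIntegral ((a + b) / 2) c = gaussIntegral a b := by
  have hp : 0 < a * b := mul_pos ha hb
  set h : ℝ → ℝ := fun u => 1 / √((u ^ 2 + ((a + b) / 2) ^ 2) * (u ^ 2 + c ^ 2)) with hdef
  set f : ℝ → ℝ := fun t => (t - a * b / t) / 2 with fdef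
  have hfull : ∫ u, h u = 2 * gaussIntegral ((a + b) / 2) c := by
    rw [gaussIntegral, ← integral_comp_abs]
    simp only [hdef, sq_abs]
  have himage : f '' Set.Ioi 0 = Set.univ := by
    refine Set.eq_univ_of_forall fun u => ⟨u + √(u ^ 2 + a * b), ?_, ?_⟩
    · have : |u| < √(u ^ 2 + a * b) := by
        rw [← sqrt_sq_eq_abs]
        exact sqrt_lt_sqrt (sq_nonneg u) (by linarith)
      exact Set.mem_Ioi.2 (by linarith [neg_abs_le u])
    · have h1 : |u| < √(u ^ 2 + a * b) := by
        rw [← sqrt_sq_eq_abs]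
        exact sqrt_lt_sqrt (sq_nonneg u) (by linarith)
      have h2 : u + √(u ^ 2 + a * b) ≠ 0 := by linarith [neg_abs_le u]
      have h3 := sq_sqrt (by positivity : 0 ≤ u ^ 2 + a * b)
      simp only [fdef]
      field_simp
      linear_combination h3
  have hinj : Set.InjOn f (Set.Ioi 0) := by
    intro x hx y hy hxy
    rw [Set.mem_Ioi] at hx hy
    simp only [fdef] at hxy
    field_simp at hxy
    have : (x - y) * (x * y + a * b) = 0 := by linear_combination hxy
    rcases mul_eq_zero.1 this with h0 | h0
    · linarith
    · nlinarith [mul_pos hx hy]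
  have hderiv : ∀ t ∈ Set.Ioi (0 : ℝ),
      HasDerivWithinAt f ((1 + a * b / t ^ 2) / 2) (Set.Ioi 0) t := by
    intro t ht
    have ht0 : t ≠ 0 := (Set.mem_Ioi.1 ht).ne'
    have := (((hasDerivAt_id t).sub ((hasDerivAt_inv ht0).const_mul (a * b))).div_const 2)
    refine (this.congr_deriv ?_).hasDerivWithinAt.congr (fun x _ => ?_) ?_
    · field_simp; ring
    · simp [fdef, div_eq_mul_inv]
    · simp [fdef, div_eq_mul_inv]
  have hsub := integral_image_eq_integral_abs_deriv_smul measurableSet_Ioi hderiv hinj h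
  rw [himage, setIntegral_univ, hfull] at hsub
  have hint : ∫ t in Set.Ioi (0 : ℝ), |(1 + a * b / t ^ 2) / 2| • h (f t)
      = ∫ t in Set.Ioi (0 : ℝ), 2 * (1 / √((t ^ 2 + a ^ 2) * (t ^ 2 + b ^ 2))) := by
    refine setIntegral_congr_fun measurableSet_Ioi fun t ht => ?_
    rw [Set.mem_Ioi] at ht
    have hX : 0 < (t ^ 2 + a ^ 2) * (t ^ 2 + b ^ 2) := by positivity
    have hsq := sq_sqrt hX.le
    have hroot : √((f t ^ 2 + ((a + b) / 2) ^ 2) * (f t ^ 2 + c ^ 2))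
        = √((t ^ 2 + a ^ 2) * (t ^ 2 + b ^ 2)) * (t + a * b / t) / (4 * t) := by
      rw [sqrt_eq_iff_mul_self_eq (by positivity) (by positivity), ← hc]
      have : ∀ S : ℝ, S * (t + a * b / t) / (4 * t) * (S * (t + a * b / t) / (4 * t))
        = S ^ 2 * ((t + a * b / t) / (4 * t)) ^ 2 := fun S => by ring
      rw [this, hsq]
      simp only [fdef]
      field_simp
      ring
    have hS := (sqrt_pos.2 hX).ne'
    simp only [hdef, smul_eq_mul]
    rw [hroot, abs_of_pos (by positivity)]
    field_simp
    ring
  rw [hint, integral_const_mul] at hsub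
  unfold gaussIntegral at hsub ⊢
  linarith

/-- The trigonometric form of Gauss's integral, by the substitution `t = b tan θ`. -/
lemma gaussIntegral_eq_trig {a b : ℝ} (ha : 0 < a) (hb : 0 < b) :
    gaussIntegral a b = ∫ θ in (0 : ℝ)..(π / 2), 1 / √(a ^ 2 * cos θ ^ 2 + b ^ 2 * sin θ ^ 2) := by
  have hcos : ∀ θ ∈ Set.Ioo 0 (π / 2), 0 < cos θ := fun θ hθ =>
    cos_pos_of_mem_Ioo ⟨by linarith [hθ.1, pi_pos], hθ.2⟩
  have himage : (fun θ => b * tan θ) '' Set.Ioo 0 (π / 2) = Set.Ioi 0 := by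
    ext t
    constructor
    · rintro ⟨θ, hθ, rfl⟩
      exact mul_pos hb (tan_pos_of_pos_of_lt_pi_div_two hθ.1 hθ.2)
    · intro ht
      refine ⟨arctan (t / b), ⟨?_, arctan_lt_pi_div_two _⟩, ?_⟩
      · exact arctan_pos.2 (div_pos ht hb)
      · simp only [tan_arctan]
        field_simp
  have hinj : Set.InjOn (fun θ => b * tan θ) (Set.Ioo 0 (π / 2)) := by
    intro x hx y hy hxy
    exact injOn_tan ⟨by linarith [hx.1, pi_pos], hx.2⟩ ⟨by linarith [hy.1, pi_pos], hy.2⟩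
      (mul_left_cancel₀ hb.ne' hxy)
  have hderiv : ∀ θ ∈ Set.Ioo 0 (π / 2),
      HasDerivWithinAt (fun θ => b * tan θ) (b * (1 / cos θ ^ 2)) (Set.Ioo 0 (π / 2)) θ :=
    fun θ hθ => ((hasDerivAt_tan (hcos θ hθ).ne').const_mul b).hasDerivWithinAt
  have hsub := integral_image_eq_integral_abs_deriv_smul measurableSet_Ioo hderiv hinj
    fun t => 1 / √((t ^ 2 + a ^ 2) * (t ^ 2 + b ^ 2))
  rw [himage] at hsub
  rw [gaussIntegral, hsub, intervalIntegral.integral_of_le (by positivity),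
    integral_Ioc_eq_integral_Ioo]
  refine setIntegral_congr_fun measurableSet_Ioo fun θ hθ => ?_
  have hc := hcos θ hθ
  have hY : 0 < a ^ 2 * cos θ ^ 2 + b ^ 2 * sin θ ^ 2 := by positivity
  have hroot : √(((b * tan θ) ^ 2 + a ^ 2) * ((b * tan θ) ^ 2 + b ^ 2))
      = b * √(a ^ 2 * cos θ ^ 2 + b ^ 2 * sin θ ^ 2) / cos θ ^ 2 := by
    rw [sqrt_eq_iff_mul_self_eq (by positivity) (by positivity)]
    have : ∀ S : ℝ, b * S / cos θ ^ 2 * (b * S / cos θ ^ 2) = S ^ 2 * (b ^ 2 / cos θ ^ 4) :=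
      fun S => by field_simp
    rw [this, sq_sqrt hY.le, tan_eq_sin_div_cos]
    have h1 := sin_sq_add_cos_sq θ
    field_simp
    linear_combination (a ^ 2 * cos θ ^ 2 + b ^ 2 * sin θ ^ 2) * h1
  have hS := (sqrt_pos.2 hY).ne'
  simp only [smul_eq_mul]
  rw [hroot, abs_of_pos (by positivity)]
  field_simp

lemma gaussIntegral_eq_ellipticK {a b : ℝ} (ha : 0 < a) (hb : 0 < b) {k : ℝ}
    (hk : k ^ 2 = 1 - b ^ 2 / a ^ 2) : gaussIntegral a b = ellipticK k / a := by
  rw [gaussIntegral_eq_trig ha hb, ellipticK, ← intervalIntegral.integral_div]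
  congr 1 with θ
  have : a ^ 2 * cos θ ^ 2 + b ^ 2 * sin θ ^ 2 = a ^ 2 * (1 - k ^ 2 * sin θ ^ 2) := by
    rw [hk, cos_sq']
    field_simp
    ring
  rw [this, sqrt_mul (sq_nonneg a), sqrt_sq ha.le, div_div, mul_comm]

lemma gaussIntegral_mem_Icc {a b : ℝ} (hb : 0 < b) (hab : b ≤ a) :
    gaussIntegral a b ∈ Set.Icc (π / 2 / a) (π / 2 / b) := by
  have ha := hb.trans_le hab
  have hsq : b ^ 2 ≤ a ^ 2 := by gcongr
  have hlow : ∀ θ, b ^ 2 ≤ a ^ 2 * cos θ ^ 2 + b ^ 2 * sin θ ^ 2 := fun θ => by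
    nlinarith [sin_sq_add_cos_sq θ, sq_nonneg (cos θ)]
  have hupp : ∀ θ, a ^ 2 * cos θ ^ 2 + b ^ 2 * sin θ ^ 2 ≤ a ^ 2 := fun θ => by
    nlinarith [sin_sq_add_cos_sq θ, sq_nonneg (sin θ)]
  have hpos : ∀ θ, 0 < a ^ 2 * cos θ ^ 2 + b ^ 2 * sin θ ^ 2 := fun θ =>
    (by positivity : 0 < b ^ 2).trans_le (hlow θ)
  have hcont : Continuous fun θ => 1 / √(a ^ 2 * cos θ ^ 2 + b ^ 2 * sin θ ^ 2) :=
    continuous_const.div (by fun_prop) fun θ => (sqrt_pos.2 (hpos θ)).ne'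
  rw [gaussIntegral_eq_trig ha hb]
  have hconst : ∀ c : ℝ, π / 2 / c = ∫ _ in (0 : ℝ)..(π / 2), 1 / c := fun c => by
    rw [intervalIntegral.integral_const, sub_zero, smul_eq_mul, mul_one_div]
  rw [hconst a, hconst b]
  constructor <;> refine intervalIntegral.integral_mono (by positivity)
    (Continuous.intervalIntegrable (by fun_prop) _ _)
    (Continuous.intervalIntegrable (by fun_prop) _ _) fun θ => ?_
  · exact one_div_le_one_div_of_le (sqrt_pos.2 (hpos θ)) ((sqrt_le_left ha.le).2 (hupp θ))
  · exact one_div_le_one_div_of_le hb ((le_sqrt hb.le (hpos θ).le).2 (hlow θ))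

/-! ### The complete elliptic integral and its series -/

lemma one_sub_sq_mul_sin_sq_pos {k : ℝ} (h0 : 0 ≤ k) (h1 : k < 1) (θ : ℝ) :
    0 < 1 - k ^ 2 * sin θ ^ 2 := by
  nlinarith [sin_sq_le_one θ, sq_nonneg (sin θ), mul_self_nonneg k]

lemma continuous_ellipticK_integrand {k : ℝ} (h0 : 0 ≤ k) (h1 : k < 1) :
    Continuous fun θ => 1 / √(1 - k ^ 2 * sin θ ^ 2) :=
  continuous_const.div (by fun_prop) fun θ => (sqrt_pos.2 (one_sub_sq_mul_sin_sq_pos h0 h1 θ)).ne'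

lemma ellipticK_strictMonoOn : StrictMonoOn ellipticK (Set.Ico 0 1) := by
  rintro k ⟨hk0, hk1⟩ l ⟨hl0, hl1⟩ hkl
  have hsq : k ^ 2 < l ^ 2 := by gcongr
  refine intervalIntegral.integral_lt_integral_of_continuousOn_of_le_of_exists_lt (by positivity)
    (continuous_ellipticK_integrand hk0 hk1).continuousOn
    (continuous_ellipticK_integrand hl0 hl1).continuousOn (fun θ _ => ?_)
    ⟨π / 2, ⟨by positivity, le_rfl⟩, ?_⟩
  · exact one_div_le_one_div_of_le (sqrt_pos.2 (one_sub_sq_mul_sin_sq_pos hl0 hl1 θ))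
      (sqrt_le_sqrt (by nlinarith [sq_nonneg (sin θ)]))
  · exact one_div_lt_one_div_of_lt (sqrt_pos.2 (one_sub_sq_mul_sin_sq_pos hl0 hl1 _))
      (sqrt_lt_sqrt (one_sub_sq_mul_sin_sq_pos hl0 hl1 _).le (by simpa using hsq))

lemma ellipticK_pos {k : ℝ} (h0 : 0 ≤ k) (h1 : k < 1) : 0 < ellipticK k :=
  intervalIntegral.intervalIntegral_pos_of_pos
    ((continuous_ellipticK_integrand h0 h1).intervalIntegrable _ _)
    (fun θ => one_div_pos.2 (sqrt_pos.2 (one_sub_sq_mul_sin_sq_pos h0 h1 θ))) (by positivity)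

/-- The Wallis ratio `(1/2)_n / n!`, the coefficient of `xⁿ` in `(1 - x) ^ (-1/2)`. -/
noncomputable def wallisRatio (n : ℕ) : ℝ := ∏ i ∈ Finset.range n, (2 * (i : ℝ) + 1) / (2 * i + 2)

lemma wallisRatio_succ (n : ℕ) :
    wallisRatio (n + 1) = wallisRatio n * ((2 * (n : ℝ) + 1) / (2 * n + 2)) :=
  Finset.prod_range_succ _ n

lemma wallisRatio_nonneg (n : ℕ) : 0 ≤ wallisRatio n :=
  Finset.prod_nonneg fun _ _ => by positivity

lemma wallisRatio_le_one (n : ℕ) : wallisRatio n ≤ 1 :=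
  Finset.prod_le_one (fun _ _ => by positivity) fun i _ => by
    rw [div_le_one (by positivity)]
    linarith

lemma wallisRatio_eq_choose (n : ℕ) :
    wallisRatio n = Ring.choose ((1 / 2 : ℝ) + n - 1) n := by
  rw [← Ring.multichoose_eq]
  apply mul_left_cancel₀ (by positivity : (n.factorial : ℝ) ≠ 0)
  have h := Ring.factorial_nsmul_multichoose_eq_ascPochhammer (1 / 2 : ℝ) n
  rw [nsmul_eq_mul, Polynomial.ascPochhammer_smeval_eq_eval] at h
  rw [h]
  clear h
  induction n with
  | zero => simp [wallisRatio]
  | succ n ih =>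
    rw [ascPochhammer_succ_eval, ← ih, wallisRatio_succ, Nat.factorial_succ]
    push_cast
    field_simp
    ring

lemma hasSum_one_div_sqrt_one_sub {x : ℝ} (h0 : 0 ≤ x) (h1 : x < 1) :
    HasSum (fun n => wallisRatio n * x ^ n) (1 / √(1 - x)) := by
  have h := (Real.one_div_one_sub_rpow_hasFPowerSeriesOnBall_zero (1 / 2)).hasSum (y := x) (by
    simp [abs_of_nonneg h0, enorm_eq_nnnorm, ← NNReal.coe_lt_coe, h1])
  simp only [FormalMultilinearSeries.ofScalars_apply_eq, zero_add, ← sqrt_eq_rpow,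
    smul_eq_mul] at h
  simpa only [wallisRatio_eq_choose] using h

lemma integral_sin_pow_even_quarter (n : ℕ) :
    ∫ θ in (0 : ℝ)..(π / 2), sin θ ^ (2 * n) = π / 2 * wallisRatio n := by
  have h : ∫ θ in (0 : ℝ)..(π / 2), sin θ ^ (2 * n) = ∫ θ in (0 : ℝ)..(π / 2), cos θ ^ (2 * n) := by
    have := intervalIntegral.integral_comp_sub_left (a := 0) (b := π / 2)
      (fun θ => cos θ ^ (2 * n)) (π / 2)
    simpa [cos_pi_div_two_sub] using this
  rw [h, EulerSine.integral_cos_pow_eq, integral_sin_pow_even, wallisRatio]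
  ring

/-- `2 K(k) / π = ∑ ((1/2)_n / n!)² k^{2n}`, by termwise integration of the binomial series. -/
lemma hasSum_ellipticK {k : ℝ} (h0 : 0 ≤ k) (h1 : k < 1) :
    HasSum (fun n => wallisRatio n ^ 2 * (k ^ 2) ^ n) (2 * ellipticK k / π) := by
  have hx1 : k ^ 2 < 1 := by nlinarith
  have h : HasSum (fun n => ∫ θ in (0 : ℝ)..(π / 2), wallisRatio n * (k ^ 2 * sin θ ^ 2) ^ n)
      (ellipticK k) := by
    refine intervalIntegral.hasSum_integral_of_dominated_convergence (fun n _ => (k ^ 2) ^ n)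
      (fun n => ?_) (fun n => .of_forall fun θ _ => ?_) (.of_forall fun θ _ => ?_) ?_
      (.of_forall fun θ _ => ?_)
    · exact Continuous.aestronglyMeasurable (by fun_prop)
    · rw [norm_of_nonneg (mul_nonneg (wallisRatio_nonneg n) (by positivity)), mul_pow]
      calc wallisRatio n * ((k ^ 2) ^ n * (sin θ ^ 2) ^ n) ≤ 1 * ((k ^ 2) ^ n * 1) := by
            gcongr
            · exact wallisRatio_le_one n
            · exact pow_le_one₀ (sq_nonneg _) (sin_sq_le_one θ)
        _ = (k ^ 2) ^ n := by ring
    · exact summable_geometric_of_lt_one (sq_nonneg k) hx1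
    · exact intervalIntegrable_const
    · exact hasSum_one_div_sqrt_one_sub (by positivity)
        (by linarith [one_sub_sq_mul_sin_sq_pos h0 h1 θ])
  have h' := (h.mul_left 2).div_const π
  refine h'.congr_fun fun n => ?_
  simp only [mul_pow, ← pow_mul]
  simp only [← mul_assoc]
  rw [intervalIntegral.integral_const_mul, integral_sin_pow_even_quarter]
  field_simp

lemma poch_succ (a : ℝ) (n : ℕ) : poch a (n + 1) = poch a n * (a + n) :=
  ascPochhammer_succ_eval n a

lemma poch_mul_poch_div (n : ℕ) :
    poch (3 / 2) n * poch (-1 / 2) n / (n.factorial : ℝ) ^ 2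
      = -(wallisRatio n ^ 2 * ((2 * n + 1) / (2 * n - 1))) := by
  induction n with
  | zero => simp [poch, wallisRatio]
  | succ n ih =>
    have hd : (2 * (n : ℝ) - 1) ≠ 0 := by
      have : (2 * (n : ℤ) - 1) ≠ 0 := by omega
      exact_mod_cast this
    have hd' : (2 * ((n : ℝ) + 1) - 1) ≠ 0 := by
      have : (0 : ℝ) ≤ n := n.cast_nonneg
      linarith
    have hstep : poch (3 / 2) (n + 1) * poch (-1 / 2) (n + 1) / ((n + 1).factorial : ℝ) ^ 2
        = poch (3 / 2) n * poch (-1 / 2) n / (n.factorial : ℝ) ^ 2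
          * ((3 / 2 + n) * (-1 / 2 + n) / (n + 1) ^ 2) := by
      rw [poch_succ, poch_succ, Nat.factorial_succ]
      push_cast
      field_simp
    rw [hstep, ih, wallisRatio_succ]
    push_cast
    field_simp
    ring

/-- The series differs from the hypergeometric series of `2 K(k) / π` by the telescoping sum of
`cₙ - cₙ₊₁`, where `cₙ = 8 n² ((1/2)_n / n!)² k^{2n} / (2n - 1)`. -/
lemma hasSum_poch_series {k : ℝ} (h0 : 0 ≤ k) (h1 : k < 1) :
    HasSum (fun n : ℕ => poch (3 / 2) n * poch (-1 / 2) n / (n.factorial : ℝ) ^ 2 * k ^ (2 * n) *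
      (-4 * (1 - k ^ 2) * (n : ℝ) + 1 - 2 * k ^ 2)) (2 * ellipticK k / π) := by
  have hx1 : k ^ 2 < 1 := by nlinarith
  set c : ℕ → ℝ := fun n => 8 * (n : ℝ) ^ 2 / (2 * n - 1) * wallisRatio n ^ 2 * (k ^ 2) ^ n
  have hc : Summable c := by
    have hg := (summable_pow_mul_geometric_of_norm_lt_one 1
      (by rwa [norm_of_nonneg (sq_nonneg k)] : ‖k ^ 2‖ < 1)).mul_left 8
    refine Summable.of_norm_bounded hg fun n => ?_
    rcases Nat.eq_zero_or_pos n with rfl | hn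
    · simp [c]
    · have hn' : (1 : ℝ) ≤ n := by exact_mod_cast hn
      have hd : (0 : ℝ) < 2 * n - 1 := by linarith
      have hw := wallisRatio_nonneg n
      rw [norm_of_nonneg (by positivity)]
      have e1 : 8 * (n : ℝ) ^ 2 / (2 * n - 1) ≤ 8 * n := by
        rw [div_le_iff₀ hd]
        nlinarith
      calc c n = 8 * (n : ℝ) ^ 2 / (2 * n - 1) * wallisRatio n ^ 2 * (k ^ 2) ^ n := rfl
        _ ≤ 8 * n * 1 * (k ^ 2) ^ n := by
            gcongr
            exact pow_le_one₀ hw (wallisRatio_le_one n)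
        _ = _ := by ring
  have hc1 : HasSum (fun n => c (n + 1)) (∑' n, c n) := by
    have := (hasSum_nat_add_iff' 1).2 hc.hasSum
    simpa [c] using this
  have h := ((hasSum_ellipticK h0 h1).add hc.hasSum).sub hc1
  rw [add_sub_cancel_right] at h
  refine h.congr_fun fun n => ?_
  have hd : (2 * (n : ℝ) - 1) ≠ 0 := by
    have : (2 * (n : ℤ) - 1) ≠ 0 := by omega
    exact_mod_cast this
  have hd' : (2 * ((n : ℝ) + 1) - 1) ≠ 0 := by
    have : (0 : ℝ) ≤ n := n.cast_nonneg
    linarith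
  simp only [c]
  rw [poch_mul_poch_div, wallisRatio_succ, pow_mul]
  push_cast
  field_simp
  ring

/-! ### The modulus as a function of the nome -/

/-- The theta parametrisation of the AGM, `agm(ϑ₃², ϑ₄²) = 1`, in terms of Gauss's integral. -/
lemma gaussIntegral_theta {s : ℝ} (hs : 0 < s) :
    gaussIntegral (thetaNull s ^ 2) (thetaAlt s ^ 2) = π / 2 := by
  have hstep : ∀ u : ℝ, 0 < u → gaussIntegral (thetaNull (2 * u) ^ 2) (thetaAlt (2 * u) ^ 2)
      = gaussIntegral (thetaNull u ^ 2) (thetaAlt u ^ 2) := by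
    intro u hu
    have h := gaussIntegral_mean (pow_pos (thetaNull_pos hu) 2) (pow_pos (thetaAlt_pos hu) 2)
      (c := thetaAlt (2 * u) ^ 2) (by rw [← mul_pow, thetaNull_mul_thetaAlt hu])
    rwa [thetaNull_sq_add_thetaAlt_sq hu, mul_div_cancel_left₀ _ (two_ne_zero' ℝ)] at h
  have hiter : ∀ n : ℕ, gaussIntegral (thetaNull (2 ^ n * s) ^ 2) (thetaAlt (2 ^ n * s) ^ 2)
      = gaussIntegral (thetaNull s ^ 2) (thetaAlt s ^ 2) := by
    intro n
    induction n with
    | zero => simp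
    | succ n ih => rw [pow_succ' 2 n, mul_assoc, hstep _ (by positivity), ih]
  have hlim : Tendsto (fun n : ℕ => 2 ^ n * s) atTop atTop :=
    (tendsto_pow_atTop_atTop_of_one_lt one_lt_two).atTop_mul_const hs
  have hbound : ∀ n : ℕ, gaussIntegral (thetaNull s ^ 2) (thetaAlt s ^ 2) ∈
      Set.Icc (π / 2 / thetaNull (2 ^ n * s) ^ 2) (π / 2 / thetaAlt (2 ^ n * s) ^ 2) := by
    intro n
    have hu : 0 < 2 ^ n * s := by positivity
    rw [← hiter n]
    exact gaussIntegral_mem_Icc (pow_pos (thetaAlt_pos hu) 2)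
      (pow_le_pow_left₀ (thetaAlt_pos hu).le (thetaAlt_lt_thetaNull hu).le 2)
  have hlow := (tendsto_const_nhds (x := π / 2)).div
    ((tendsto_thetaNull_atTop.comp hlim).pow 2) (by norm_num)
  have hupp := (tendsto_const_nhds (x := π / 2)).div
    ((tendsto_thetaAlt_atTop.comp hlim).pow 2) (by norm_num)
  rw [one_pow, div_one] at hlow hupp
  exact le_antisymm (ge_of_tendsto' hupp fun n => (hbound n).2)
    (le_of_tendsto' hlow fun n => (hbound n).1)

/-- The modulus at the nome `exp (-π s)`: `k = ϑ₂² / ϑ₃²`, written as the complementary modulus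
`ϑ₄² / ϑ₃²` at the inverse argument. -/
noncomputable def thetaModulus (s : ℝ) : ℝ := (thetaAlt s⁻¹ / thetaNull s⁻¹) ^ 2

lemma thetaModulus_pos {s : ℝ} (hs : 0 < s) : 0 < thetaModulus s :=
  pow_pos (div_pos (thetaAlt_pos (inv_pos.2 hs)) (thetaNull_pos (inv_pos.2 hs))) 2

lemma thetaModulus_sq_add {s : ℝ} (hs : 0 < s) :
    thetaModulus s ^ 2 + thetaModulus s⁻¹ ^ 2 = 1 := by
  have h := thetaNull_pow_four hs
  have hT := thetaNull_pos hs
  rw [thetaModulus, thetaModulus, inv_inv, thetaNull_inv hs, div_pow, mul_pow, sq_sqrt hs.le]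
  field_simp at h ⊢
  linear_combination -h

lemma thetaModulus_lt_one {s : ℝ} (hs : 0 < s) : thetaModulus s < 1 := by
  nlinarith [thetaModulus_sq_add hs, thetaModulus_pos hs, thetaModulus_pos (inv_pos.2 hs)]

lemma sqrt_one_sub_thetaModulus_sq {s : ℝ} (hs : 0 < s) :
    √(1 - thetaModulus s ^ 2) = thetaModulus s⁻¹ := by
  rw [← thetaModulus_sq_add hs, add_sub_cancel_left, sqrt_sq (thetaModulus_pos (inv_pos.2 hs)).le]

lemma ellipticK_thetaModulus {s : ℝ} (hs : 0 < s) :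
    2 * ellipticK (thetaModulus s) / π = thetaNull s ^ 2 := by
  have hT := thetaNull_pos hs
  have h := gaussIntegral_eq_ellipticK (pow_pos hT 2) (pow_pos (thetaAlt_pos hs) 2)
    (k := thetaModulus s) (by
      rw [← thetaModulus_sq_add hs, ← div_pow, ← div_pow]
      simp only [thetaModulus, inv_inv]
      ring)
  rw [gaussIntegral_theta hs] at h
  field_simp at h ⊢
  linarith

lemma isSingularModulus_thetaModulus {r : ℝ} (hr : 0 < r) :
    IsSingularModulus r (thetaModulus √r) := by
  have hs := sqrt_pos.2 hr
  refine ⟨thetaModulus_pos hs, thetaModulus_lt_one hs, ?_⟩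
  have h1 := ellipticK_thetaModulus hs
  have h2 := ellipticK_thetaModulus (inv_pos.2 hs)
  have hK := ellipticK_pos (thetaModulus_pos hs).le (thetaModulus_lt_one hs)
  rw [thetaNull_inv hs, mul_pow, sq_sqrt hs.le, ← h1] at h2
  rw [sqrt_one_sub_thetaModulus_sq hs, div_eq_iff hK.ne']
  field_simp at h2
  simpa only [one_div] using h2

/-- `K(√(1 - k²)) / K(k)` is strictly decreasing in `k`. -/
lemma ellipticK_ratio_strictAntiOn :
    StrictAntiOn (fun k => ellipticK √(1 - k ^ 2) / ellipticK k) (Set.Ioo 0 1) := by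
  rintro k ⟨hk0, hk1⟩ l ⟨hl0, hl1⟩ hkl
  have hsq : k ^ 2 < l ^ 2 := by gcongr
  have hl2 : l ^ 2 < 1 := by nlinarith
  have hlt : ∀ m : ℝ, 0 < m → √(1 - m ^ 2) < 1 := fun m hm => by
    rw [sqrt_lt' one_pos]
    nlinarith [pow_pos hm 2]
  have hK := ellipticK_strictMonoOn ⟨hk0.le, hk1⟩ ⟨hl0.le, hl1⟩ hkl
  have hK' := ellipticK_strictMonoOn ⟨sqrt_nonneg (1 - l ^ 2), hlt l hl0⟩
    ⟨sqrt_nonneg (1 - k ^ 2), hlt k hk0⟩ (sqrt_lt_sqrt (by linarith) (by linarith))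
  exact div_lt_div₀ hK' hK.le (ellipticK_pos (sqrt_nonneg _) (hlt k hk0)).le
    (ellipticK_pos hk0.le hk1)

lemma IsSingularModulus.unique {r k l : ℝ} (hk : IsSingularModulus r k)
    (hl : IsSingularModulus r l) : k = l :=
  ellipticK_ratio_strictAntiOn.injOn ⟨hk.1, hk.2.1⟩ ⟨hl.1, hl.2.1⟩ (hk.2.2.trans hl.2.2.symm)

end SingularModuli

theorem proposition1 (r : ℝ) (hr : 0 < r) :
    (∃! k : ℝ, SingularModuli.IsSingularModulus r k) ∧
    ∀ k : ℝ, SingularModuli.IsSingularModulus r k →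
      HasSum
        (fun n : ℕ =>
          SingularModuli.poch (3 / 2) n * SingularModuli.poch (-1 / 2) n / (n.factorial : ℝ) ^ 2 *
            k ^ (2 * n) * (-4 * (1 - k ^ 2) * (n : ℝ) + 1 - 2 * k ^ 2))
        (2 * SingularModuli.ellipticK k / Real.pi) ∧
      2 * SingularModuli.ellipticK k / Real.pi =
        SingularModuli.theta3 (Real.exp (-Real.pi * Real.sqrt r)) ^ 2 := by
  have hmod := SingularModuli.isSingularModulus_thetaModulus hr
  refine ⟨⟨_, hmod, fun k hk => hk.unique hmod⟩, fun k hk => ⟨?_, ?_⟩⟩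
  · exact SingularModuli.hasSum_poch_series hk.1.le hk.2.1
  · rw [hk.unique hmod, SingularModuli.theta3_exp]
    exact SingularModuli.ellipticK_thetaModulus (Real.sqrt_pos.2 hr)
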